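/- Let $\mathbb N=\{0,1,2,\ldots\}$, and let $a>0$ and $b>-a$ be integers with $b$ even and $\gcd(a,b)=1$. Then, for any integer $n\not\equiv 0\pmod 4$ with $$n>4a(7a(a-1)+1)+2(7a-2)b+2(2a(2a-1)+b)\sqrt{6(2a(a-1)+b)},$$ there are $w,x,y,z\in\mathbb N$ such that $$n=w(aw+b)+x(ax+b)+y(ay+b)+z(az+b).$$ Consequently, the set $A=\{x(ax+b):x\in\mathbb N\}$ is an asymptotic base of order five; that is, $A\subseteq\mathbb N$ and all but finitely many elements of $\mathbb N$ can be written as $a_1+a_2+a_3+a_4+a_5$ with $a_1,\ldots,a_5\in A$. -/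

import Mathlib

/-- The `k`-fold sumset `kA = {a₁ + ⋯ + aₖ : a₁, …, aₖ ∈ A}` (repetitions allowed)
of a set `A` of integers. -/
def kFoldSumset (k : ℕ) (A : Set ℤ) : Set ℤ :=
  {m | ∃ f : Fin k → ℤ, (∀ i, f i ∈ A) ∧ m = ∑ i, f i}

/-- A set `A` of integers is an asymptotic base of order `k` if it consists of nonnegative
integers and all but finitely many nonnegative integers lie in the `k`-fold sumset `kA`. -/
def IsAsymptoticBase (A : Set ℤ) (k : ℕ) : Prop :=
  (∀ m ∈ A, 0 ≤ m) ∧ {m : ℤ | 0 ≤ m ∧ m ∉ kFoldSumset k A}.Finite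

/-! With s the sum and q the sum of squares of w, x, y, z, the equation reads n = aq + bs. Cauchy's
lemma supplies natural w, x, y, z once the parities fit, s² ≤ 4q and 3q < s² + 2s + 4. Substituting
q = (n - bs)/a confines s to an interval, longer than 2a when n is large, so s can be taken in the
class mod 2a that makes q integral and s ≡ n mod 2. Cauchy's lemma rests on the three squares
theorem, proved by finding a ternary form of determinant 1 that represents the given number. For
order five, one extra term moves n off the multiples of 4. -/

/-- An integer is a sum of three squares. -/
def IsSumThreeSq (m : ℤ) : Prop := ∃ x y z : ℤ, m = x ^ 2 + y ^ 2 + z ^ 2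

/-! ### Reduction of ternary forms of determinant 1 -/

theorem exists_shear (a d : ℤ) (ha : 0 < a) : ∃ k : ℤ, |2 * (d + k * a)| ≤ a := by
  refine ⟨-((2 * d + a) / (2 * a)), ?_⟩
  have h1 := Int.emod_add_mul_ediv (2 * d + a) (2 * a)
  have h2 := Int.emod_nonneg (2 * d + a) (show 2 * a ≠ 0 by lia)
  have h3 := Int.emod_lt_of_pos (2 * d + a) (show 0 < 2 * a by lia)
  rw [abs_le]
  constructor <;> nlinarith

/-- A reduced positive definite ternary form of determinant `1` is the sum of three squares. -/
theorem eq_one_of_reduced {a b c d e f : ℤ} (ha : 0 < a) (hg : 0 < a * b - d ^ 2)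
    (hprod : (a * b - d ^ 2) * (a * c - e ^ 2) - (a * f - d * e) ^ 2 = a)
    (hab : a ≤ b) (hgg : a * b - d ^ 2 ≤ a * c - e ^ 2)
    (hd : |2 * d| ≤ a) (he : |2 * e| ≤ a) (hj : |2 * (a * f - d * e)| ≤ a * b - d ^ 2) :
    a = 1 ∧ b = 1 ∧ c = 1 ∧ d = 0 ∧ e = 0 ∧ f = 0 := by
  have hd2 : 4 * d ^ 2 ≤ a ^ 2 := by
    have := sq_le_sq' (by linarith [abs_nonneg (2 * d)]) hd
    rw [sq_abs] at this
    linarith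
  have hj2 : 4 * (a * f - d * e) ^ 2 ≤ (a * b - d ^ 2) ^ 2 := by
    have := sq_le_sq' (by linarith [abs_nonneg (2 * (a * f - d * e))]) hj
    rw [sq_abs] at this
    linarith
  obtain ⟨g, hg1⟩ : ∃ g, g = a * b - d ^ 2 := ⟨_, rfl⟩
  have h1 : 3 * g ^ 2 ≤ 4 * a := by
    have := mul_le_mul_of_nonneg_left hgg hg.le
    rw [hg1]
    linarith
  have h2 : 3 * a ^ 2 ≤ 4 * g := by
    have := mul_le_mul_of_nonneg_left hab ha.le
    rw [hg1]
    linarith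
  -- Together `h1` and `h2` give 27a³ ≤ 64.
  have ha1 : a = 1 := by
    have h3 : a < 2 := by
      by_contra h
      have h4 : 2 * a ≤ a ^ 2 := by nlinarith only [h]
      nlinarith only [h4, h1, h2, h, ha]
    lia
  have hg0 : g = 1 := by
    have : g < 2 := by nlinarith only [h1, ha1]
    lia
  subst ha1
  have hd0 : d = 0 := by rw [abs_le] at hd; lia
  have he0 : e = 0 := by rw [abs_le] at he; lia
  subst hd0 he0
  have hb1 : b = 1 := by linarith
  subst hb1
  have hf0 : f = 0 := by rw [abs_le] at hj; lia
  subst hf0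
  exact ⟨rfl, rfl, by linarith, rfl, rfl, rfl⟩

/-- A positive definite integral ternary quadratic form with integral Gram matrix of
determinant `1` represents only sums of three squares. -/
theorem isSumThreeSq_of_det_eq_one (A G : ℕ) : ∀ a b c d e f : ℤ, a = A → a * b - d ^ 2 = G →
    0 < a → 0 < a * b - d ^ 2 →
    a * b * c + 2 * d * e * f - a * f ^ 2 - b * e ^ 2 - c * d ^ 2 = 1 →
    ∀ x y z : ℤ, IsSumThreeSq (a * x ^ 2 + b * y ^ 2 + c * z ^ 2 + 2 * d * x * y
      + 2 * e * x * z + 2 * f * y * z) := by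
  -- Lexicographic descent on (a, ab - d²): swapping x, y lowers a; swapping y, z keeps a and lowers
  -- the minor.
  induction A using Nat.strong_induction_on generalizing G with
  | _ A ihA =>
  induction G using Nat.strong_induction_on with
  | _ G ihG =>
  intro a b c d e f hA hG ha hg hdet
  -- it suffices to treat reduced forms
  suffices H : ∀ b c d e f : ℤ, a * b - d ^ 2 = G → 0 < a * b - d ^ 2 →
      a * b * c + 2 * d * e * f - a * f ^ 2 - b * e ^ 2 - c * d ^ 2 = 1 →
      |2 * d| ≤ a → |2 * e| ≤ a → |2 * (a * f - d * e)| ≤ a * b - d ^ 2 →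
      ∀ x y z : ℤ, IsSumThreeSq (a * x ^ 2 + b * y ^ 2 + c * z ^ 2 + 2 * d * x * y
      + 2 * e * x * z + 2 * f * y * z) by
    intro x y z
    -- The shear by m shifts af - de by m(ab - d²); the shears by k and l leave it fixed.
    obtain ⟨m, hm⟩ := exists_shear _ (a * f - d * e) hg
    obtain ⟨k, hk⟩ := exists_shear a d ha
    obtain ⟨l, hl⟩ := exists_shear a (e + m * d) ha
    have := H (b + 2 * k * d + k ^ 2 * a)
      (c + 2 * m * f + m ^ 2 * b + 2 * l * (e + m * d) + l ^ 2 * a) (d + k * a)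
      (e + m * d + l * a) (f + m * b + k * (e + m * d) + l * d + k * l * a)
      (by rw [← hG]; ring) (by convert hg using 1; ring)
      (by rw [← hdet]; ring) hk hl (by convert hm using 1 <;> ring_nf)
      (x - k * (y - m * z) - l * z) (y - m * z) z
    convert this using 1
    ring
  clear hdet hg hG b c d e f
  intro b c d e f hG hg hdet hd he hgf x y z
  have hb : 0 < b := by
    by_contra hb
    nlinarith [sq_nonneg d]
  have hprod : (a * b - d ^ 2) * (a * c - e ^ 2) - (a * f - d * e) ^ 2 = a := by
    linear_combination a * hdet
  have hg2 : 0 < a * c - e ^ 2 := by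
    by_contra hb
    nlinarith [sq_nonneg (a * f - d * e)]
  by_cases hba : b < a
  · have := ihA b.toNat (by lia) (b * a - d ^ 2).toNat b a c d f e (by lia)
      (by rw [mul_comm b a]; lia) hb (by linarith) (by linarith) y x z
    convert this using 1
    ring
  by_cases hgg : a * c - e ^ 2 < a * b - d ^ 2
  · have := ihG (a * c - e ^ 2).toNat (by lia) a c b e d f hA (by lia) ha hg2 (by linarith) x z y
    convert this using 1
    ring
  push Not at hba hgg
  obtain ⟨rfl, rfl, rfl, rfl, rfl, rfl⟩ :=
    eq_one_of_reduced ha hg hprod hba hgg hd he hgf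
  exact ⟨x, y, z, by ring⟩

/-! ### Three squares via Dirichlet's theorem and reciprocity -/

/-- If `-d` is a square modulo `d * n - 1`, then `n` is a sum of three squares. -/
theorem isSumThreeSq_of_dvd {n d k : ℤ} (hd : 0 < d) (hn : 0 < d * n - 1)
    (h : d * n - 1 ∣ k ^ 2 + d) : IsSumThreeSq n := by
  obtain ⟨a, ha⟩ := h
  have hk : 0 < (d * n - 1) * a := by rw [← ha]; positivity
  have ha0 : 0 < a := (mul_pos_iff_of_pos_left hn).1 hk
  have hg : a * (d * n - 1) - k ^ 2 = d := by linarith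
  -- The Gram matrix [[a, k, 1], [k, dn - 1, 0], [1, 0, n]] has determinant 1 and takes the value n
  -- at (0, 0, 1).
  have := isSumThreeSq_of_det_eq_one a.toNat d.toNat a (d * n - 1) n k 1 0 (by lia) (by lia) ha0
    (by lia) (by linear_combination n * hg) 0 0 1
  simpa using this

theorem exists_dvd_sq_add_of_jacobiSym {p : ℕ} [Fact p.Prime] {d : ℤ}
    (h : jacobiSym (-d) p = 1) : ∃ k : ℤ, (p : ℤ) ∣ k ^ 2 + d := by
  have h0 : ((-d : ℤ) : ZMod p) ≠ 0 := by
    intro h0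
    rw [← jacobiSym.legendreSym.to_jacobiSym, (legendreSym.eq_zero_iff p (-d)).2 h0] at h
    norm_num at h
  rw [← jacobiSym.legendreSym.to_jacobiSym, legendreSym.eq_one_iff p h0] at h
  obtain ⟨r, hr⟩ := h
  refine ⟨r.val, ?_⟩
  rw [← ZMod.intCast_zmod_eq_zero_iff_dvd]
  push_cast at hr ⊢
  rw [ZMod.natCast_zmod_val, sq, ← hr]
  ring

/-- Take a prime p = dn - 1 with d = 4j + 1. Then p ≡ 1 mod 4 and (-d/p) = (p/d) = (-1/d) = 1. -/
theorem isSumThreeSq_of_mod_four_eq_two {n : ℕ} (hn : n % 4 = 2) : IsSumThreeSq n := by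
  have hcop : (n - 1).Coprime (4 * n) := by
    have h1 : (n - 1).Coprime n := by
      have := (Nat.coprime_self_add_right (m := n - 1) (n := 1)).2 (by simp)
      rwa [Nat.sub_add_cancel (by lia)] at this
    have h2 : (n - 1).Coprime 4 := by
      rw [show 4 = 2 ^ 2 by rfl]
      exact Nat.Coprime.pow_right _ (Nat.coprime_two_right.2 (by rw [Nat.odd_iff]; lia))
    exact h2.mul_right h1
  obtain ⟨p, hpn, hp, hpm⟩ := Nat.forall_exists_prime_gt_and_modEq (4 * n)
    (q := 4 * n) (by lia) hcop
  have := Fact.mk hp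
  obtain ⟨j, hj⟩ : ∃ j, p = 4 * n * j + (n - 1) := by
    refine ⟨p / (4 * n), ?_⟩
    have h1 := Nat.div_add_mod p (4 * n)
    have h2 : p % (4 * n) = n - 1 := by
      rw [hpm, Nat.mod_eq_of_lt (by lia)]
    lia
  have hpd : (p : ℤ) = (4 * j + 1 : ℕ) * n - 1 := by
    rw [hj]; push_cast [show 1 ≤ n by lia]; ring
  have hp4 : p % 4 = 1 := by
    rw [hj, mul_assoc]; omega
  have hJ : jacobiSym (-((4 * j + 1 : ℕ) : ℤ)) p = 1 := by
    rw [jacobiSym.neg _ (Nat.odd_iff.2 (by lia)), ZMod.χ₄_nat_one_mod_four hp4, one_mul,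
      jacobiSym.quadratic_reciprocity_one_mod_four (by lia) (Nat.odd_iff.2 (by lia)),
      jacobiSym.mod_left' (b := 4 * j + 1) (a₂ := -1), jacobiSym.at_neg_one
        (Nat.odd_iff.2 (by lia)), ZMod.χ₄_nat_one_mod_four (by lia)]
    rw [hpd]
    apply Int.ModEq.symm
    rw [Int.modEq_iff_dvd]
    exact ⟨n, by ring⟩
  obtain ⟨k, hk⟩ := exists_dvd_sq_add_of_jacobiSym hJ
  exact isSumThreeSq_of_dvd (d := (4 * j + 1 : ℕ)) (by positivity)
    (by rw [← hpd]; exact_mod_cast hp.pos) (by rw [← hpd]; exact hk)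

/-- Take a prime p with 2p = Dn - 1, D = 8j + c. As -2p ≡ 1 mod D and (-2/D) = 1, also (p/D) = 1. If
p ≡ 3 mod 4, then D ≡ 3 mod 4 too, and the signs from (-1/p) and reciprocity cancel. -/
theorem isSumThreeSq_of_odd {n c : ℕ} (hc : c % 8 = 1 ∨ c % 8 = 3) (hc8 : c < 8)
    (hcn : c * n % 8 = 3 ∨ c * n % 8 = 7 ∧ c % 8 = 3) : IsSumThreeSq n := by
  set r := (c * n - 1) / 2 with hr
  have hr2 : 2 * r + 1 = c * n := by lia
  have hn0 : 0 < n := Nat.pos_of_ne_zero (by rintro rfl; lia)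
  have hcop : r.Coprime (4 * n) := by
    have h1 : r.Coprime n := by
      have h : r.Coprime (c * n) := by
        rw [← hr2]
        simp
      exact h.coprime_mul_left_right
    have h2 : r.Coprime 4 := by
      rw [show 4 = 2 ^ 2 by rfl]
      exact Nat.Coprime.pow_right _ (Nat.coprime_two_right.2 (by rw [Nat.odd_iff]; lia))
    exact h2.mul_right h1
  obtain ⟨p, hpn, hp, hpm⟩ := Nat.forall_exists_prime_gt_and_modEq (4 * n)
    (q := 4 * n) (by lia) hcop
  have := Fact.mk hp
  have hrn : r < 4 * n := by nlinarith
  obtain ⟨j, hj⟩ : ∃ j, p = 4 * n * j + r := by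
    refine ⟨p / (4 * n), ?_⟩
    have h1 := Nat.div_add_mod p (4 * n)
    have h2 : p % (4 * n) = r := by
      rw [hpm, Nat.mod_eq_of_lt hrn]
    lia
  obtain ⟨D, hD⟩ : ∃ D, D = 8 * j + c := ⟨_, rfl⟩
  have hpd : 2 * (p : ℤ) = D * n - 1 := by
    have : 2 * p + 1 = D * n := by rw [hj, hD, add_mul, ← hr2]; ring
    exact eq_sub_of_add_eq (by exact_mod_cast this)
  have hp4 : p % 4 = r % 4 := by
    rw [hj, mul_assoc]; omega
  have hDo : Odd D := Nat.odd_iff.2 (by lia)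
  have hpo : Odd p := Nat.odd_iff.2 (by lia)
  have hJp : jacobiSym p D = 1 := by
    have h2 : jacobiSym (-2) D = 1 := by
      rw [jacobiSym.at_neg_two hDo, ZMod.χ₈'_nat_eq_if_mod_eight]
      have : D % 8 = 1 ∨ D % 8 = 3 := by lia
      rw [if_neg (by lia), if_pos this]
    have h1 : jacobiSym (-2 * p) D = 1 := by
      rw [jacobiSym.mod_left' (b := D) (a₂ := 1), jacobiSym.one_left]
      rw [neg_mul, hpd]
      apply Int.ModEq.symm
      rw [Int.modEq_iff_dvd]
      exact ⟨-n, by ring⟩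
    rwa [jacobiSym.mul_left, h2, one_mul] at h1
  have hJ : jacobiSym (-(D : ℤ)) p = 1 := by
    rw [jacobiSym.neg _ hpo]
    rcases hcn with h | ⟨h, hc3⟩
    · rw [ZMod.χ₄_nat_one_mod_four (by lia), one_mul,
        jacobiSym.quadratic_reciprocity_one_mod_four' hDo (by lia), hJp]
    · rw [ZMod.χ₄_nat_three_mod_four (by lia),
        jacobiSym.quadratic_reciprocity_three_mod_four (by lia) (by lia), hJp]
      rfl
  obtain ⟨k, hk⟩ := exists_dvd_sq_add_of_jacobiSym hJ
  -- An odd root makes k'² + D even, so 2p divides it.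
  obtain ⟨k', hk', hodd⟩ : ∃ k' : ℤ, (p : ℤ) ∣ k' ^ 2 + D ∧ Odd k' := by
    rcases Int.even_or_odd k with h | h
    · refine ⟨k + p, ?_, h.add_odd (by exact_mod_cast hpo)⟩
      rw [show (k + p) ^ 2 + (D : ℤ) = k ^ 2 + D + p * (2 * k + p) by ring]
      exact hk.add (dvd_mul_right _ _)
    · exact ⟨k, hk, h⟩
  refine isSumThreeSq_of_dvd (k := k') (d := D) (by have := hDo.pos; exact_mod_cast this)
    (by rw [← hpd]; have := hp.pos; positivity) ?_
  rw [← hpd]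
  refine IsCoprime.mul_dvd ?_ ?_ hk'
  · rw [Int.isCoprime_iff_gcd_eq_one]
    exact_mod_cast Nat.coprime_two_left.2 hpo
  · exact (hodd.pow.add_odd (by exact_mod_cast hDo)).two_dvd

/-- The part of the three squares theorem for integers not divisible by `4`. -/
theorem isSumThreeSq_of_mod {m : ℤ} (hm : 0 ≤ m) (h : m % 4 = 1 ∨ m % 4 = 2 ∨ m % 8 = 3) :
    IsSumThreeSq m := by
  lift m to ℕ using hm
  rcases h with h | h | h
  · exact isSumThreeSq_of_odd (c := 3) (by lia) (by lia) (by lia)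
  · exact isSumThreeSq_of_mod_four_eq_two (by lia)
  · exact isSumThreeSq_of_odd (c := 1) (by lia) (by lia) (by lia)

/-! ### Cauchy's lemma -/

/-- Four integers with given sum and sum of squares are nonnegative when the sum of squares
is not too large. -/
theorem nonneg_of_sum_sq {w x y z : ℤ} (hs : 0 ≤ w + x + y + z)
    (h : 3 * (w ^ 2 + x ^ 2 + y ^ 2 + z ^ 2)
      < (w + x + y + z) ^ 2 + 2 * (w + x + y + z) + 4) : 0 ≤ w := by
  by_contra hw
  have hw1 : w ≤ -1 := by lia
  -- By Cauchy–Schwarz, 3q ≥ 3w² + (s - w)² = s² - 2sw + 4w² ≥ s² + 2s + 4 if w ≤ -1.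
  nlinarith only [sq_nonneg (x - y), sq_nonneg (x - z), sq_nonneg (y - z), hw1, hs, h,
    mul_nonneg (show 0 ≤ -1 - w by lia) (show 0 ≤ -1 - w by lia),
    mul_nonneg hs (show 0 ≤ -1 - w by lia)]

theorem exists_nat_of_exists_int {q s : ℤ} (hs : 0 ≤ s) (h : 3 * q < s ^ 2 + 2 * s + 4)
    (hex : ∃ w x y z : ℤ, w + x + y + z = s ∧ w ^ 2 + x ^ 2 + y ^ 2 + z ^ 2 = q) :
    ∃ w x y z : ℕ, (w + x + y + z : ℤ) = s ∧ (w ^ 2 + x ^ 2 + y ^ 2 + z ^ 2 : ℤ) = q := by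
  obtain ⟨w, x, y, z, rfl, rfl⟩ := hex
  lift w to ℕ using nonneg_of_sum_sq (x := x) (y := y) (z := z) hs h
  lift x to ℕ using nonneg_of_sum_sq (w := x) (x := w) (y := y) (z := z)
    (by linarith) (by ring_nf at h ⊢; exact h)
  lift y to ℕ using nonneg_of_sum_sq (w := y) (x := w) (y := x) (z := z)
    (by linarith) (by ring_nf at h ⊢; exact h)
  lift z to ℕ using nonneg_of_sum_sq (w := z) (x := w) (y := x) (z := y)
    (by linarith) (by ring_nf at h ⊢; exact h)
  exact ⟨w, x, y, z, rfl, rfl⟩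

/-- Since 4q - s² ≡ 3 mod 8, it is a sum of three odd squares x² + y² + z². With the sign of z
chosen so that 4 ∣ s + x + y + z, the numbers (s ± x ± y ± z)/4 with an even number of minus signs
work. -/
theorem exists_int_of_odd {q s : ℤ} (hq : Odd q) (hs : Odd s) (h : s ^ 2 ≤ 4 * q) :
    ∃ w x y z : ℤ, w + x + y + z = s ∧ w ^ 2 + x ^ 2 + y ^ 2 + z ^ 2 = q := by
  obtain ⟨t, rfl⟩ := hq
  obtain ⟨r, rfl⟩ := hs
  obtain ⟨u, hu⟩ := (Int.even_mul_succ_self r).two_dvd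
  obtain ⟨x, y, z, hxyz⟩ := isSumThreeSq_of_mod (m := 4 * (2 * t + 1) - (2 * r + 1) ^ 2)
    (by linarith) (Or.inr (Or.inr (by
      rw [show 4 * (2 * t + 1) - (2 * r + 1) ^ 2 = 8 * t - 8 * u + 3 by
        linear_combination -4 * hu]
      lia)))
  have key : x ^ 2 + y ^ 2 + z ^ 2 = 8 * (t - u) + 3 := by linear_combination -hxyz - 4 * hu
  have hsq : ∀ v : ℤ, v ^ 2 % 8 = 0 ∨ v ^ 2 % 8 = 4 ∨ v % 2 = 1 ∧ v ^ 2 % 8 = 1 := by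
    intro v
    have : v % 8 = 0 ∨ v % 8 = 1 ∨ v % 8 = 2 ∨ v % 8 = 3 ∨ v % 8 = 4 ∨ v % 8 = 5 ∨ v % 8 = 6
      ∨ v % 8 = 7 := by lia
    rcases this with h | h | h | h | h | h | h | h <;>
      simp [pow_two, Int.mul_emod, h] <;> lia
  have hx := hsq x
  have hy := hsq y
  have hz := hsq z
  have hx1 : x % 2 = 1 := by omega
  have hy1 : y % 2 = 1 := by omega
  have hz1 : z % 2 = 1 := by omega
  obtain ⟨z', hz', hd⟩ : ∃ z', z' ^ 2 = z ^ 2 ∧ 4 ∣ 2 * r + 1 + x + y + z' := by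
    have : 4 ∣ 2 * r + 1 + x + y + z ∨ 4 ∣ 2 * r + 1 + x + y + -z := by lia
    rcases this with h | h
    · exact ⟨z, rfl, h⟩
    · exact ⟨-z, by ring, h⟩
  obtain ⟨k, hk⟩ := hd
  obtain ⟨x', rfl⟩ : ∃ x', x = 2 * x' + 1 := ⟨x / 2, by lia⟩
  obtain ⟨y', rfl⟩ : ∃ y', y = 2 * y' + 1 := ⟨y / 2, by lia⟩
  refine ⟨k, r + x' + 1 - k, r + y' + 1 - k, k - x' - y' - 1, by ring, ?_⟩
  have hz2 : z' = 4 * k - 2 * r - 2 * x' - 2 * y' - 3 := by linarith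
  rw [← hz', hz2] at hxyz
  linarith

/-- The same transform with s = 2t and q - t² ≡ 1 or 2 mod 4; parity alone makes the halves
integral. -/
theorem exists_int_of_even {q s : ℤ} (hq : q % 4 = 2) (hs : Even s) (h : s ^ 2 ≤ 4 * q) :
    ∃ w x y z : ℤ, w + x + y + z = s ∧ w ^ 2 + x ^ 2 + y ^ 2 + z ^ 2 = q := by
  obtain ⟨t, rfl⟩ := hs.two_dvd
  have ht : t ^ 2 % 4 = 0 ∨ t ^ 2 % 4 = 1 := by
    rcases Int.even_or_odd t with h | h
    · exact Or.inl (Int.emod_eq_zero_of_dvd (by simpa using pow_dvd_pow_of_dvd h.two_dvd 2))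
    · exact Or.inr (Int.sq_mod_four_eq_one_of_odd h)
  obtain ⟨x, y, z, hxyz⟩ := isSumThreeSq_of_mod (m := q - t ^ 2) (by linarith) (by lia)
  have hpar : ∀ v : ℤ, v ^ 2 % 2 = v % 2 := by
    intro v
    rcases Int.emod_two_eq_zero_or_one v with h | h <;> simp [pow_two, Int.mul_emod, h]
  have h1 := hpar x
  have h2 := hpar y
  have h3 := hpar z
  have h4 := hpar t
  obtain ⟨k, hk⟩ : (2 : ℤ) ∣ t + x + y + z := by omega
  refine ⟨k, t + x - k, t + y - k, t + z - k, by linarith, ?_⟩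
  obtain rfl : z = 2 * k - t - x - y := by linarith
  linarith

/-- A version of Cauchy's lemma. -/
theorem exists_nat_sum_eq_sum_sq_eq {q s : ℤ} (hq : Odd q ∧ Odd s ∨ q % 4 = 2 ∧ Even s)
    (hs : 0 ≤ s) (h1 : s ^ 2 ≤ 4 * q) (h2 : 3 * q < s ^ 2 + 2 * s + 4) :
    ∃ w x y z : ℕ, (w + x + y + z : ℤ) = s ∧ (w ^ 2 + x ^ 2 + y ^ 2 + z ^ 2 : ℤ) = q := by
  refine exists_nat_of_exists_int hs h2 ?_
  rcases hq with ⟨h, h'⟩ | ⟨h, h'⟩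
  · exact exists_int_of_odd h h' h1
  · exact exists_int_of_even h h' h1

/-! ### Choosing the sum s -/

theorem exists_modEq_between (r m : ℤ) (hm : 0 < m) {L U : ℝ} (h : m < U - L) :
    ∃ s : ℤ, m ∣ s - r ∧ L < s ∧ s < U := by
  have hm' : (0 : ℝ) < m := by exact_mod_cast hm
  refine ⟨r + m * (⌊(L - r) / m⌋ + 1), by simp, ?_, ?_⟩
  · have := Int.lt_floor_add_one ((L - r) / m)
    rw [div_lt_iff₀ hm'] at this
    push_cast
    linarith
  · have := Int.floor_le ((L - r) / m)
    rw [le_div_iff₀ hm'] at this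
    push_cast
    linarith

theorem exists_residue {a b n : ℤ} (ha : Odd a) (hab : Int.gcd a b = 1) :
    ∃ r : ℤ, ∀ s, 2 * a ∣ s - r → a ∣ n - b * s ∧ (2 : ℤ) ∣ s - n := by
  have hb' : IsCoprime b a := (Int.isCoprime_iff_gcd_eq_one.2 hab).symm
  obtain ⟨u, v, huv⟩ := hb'
  obtain ⟨k, hk⟩ := ha
  -- Chinese remainder: this is un ≡ n/b mod a, and ≡ n mod 2 because a is odd.
  refine ⟨u * n + a * (u * n + n), fun s hs => ?_⟩
  obtain ⟨t, ht⟩ := hs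
  obtain rfl : s = u * n + a * (u * n + n) + 2 * a * t := by linarith
  constructor
  · refine ⟨v * n - b * (u * n + n) - 2 * b * t, ?_⟩
    linear_combination -n * huv
  · refine ⟨u * n + k * (u * n + n) + a * t, ?_⟩
    rw [hk]
    ring

/-- The larger roots of the two quadratics in s are 2(X - b)/a and (Y - 2a - 3b)/(2a). Their gap
exceeds 2a exactly when 4X > Y + c, with c = 4a² - 2a + b. The bound on n amounts to Y > 3c + 4aR,
which implies this after squaring. -/
theorem exists_bounded_residue {a b n : ℤ} (ha : 0 < a) (hb : -a < b) (r : ℤ)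
    (hn : 4 * (a : ℝ) * (7 * a * (a - 1) + 1) + 2 * (7 * a - 2) * b
          + 2 * (2 * a * (2 * a - 1) + b) * Real.sqrt (6 * (2 * a * (a - 1) + b)) < (n : ℝ))
    (hR : 0 ≤ 2 * a * (a - 1) + b) :
    ∃ s : ℤ, 2 * a ∣ s - r ∧ 0 ≤ s ∧ a * s ^ 2 + 4 * b * s < 4 * n ∧
      3 * n < a * s ^ 2 + (2 * a + 3 * b) * s + 4 * a := by
  have ha1 : (1 : ℝ) ≤ a := by exact_mod_cast ha
  have hb1 : -(a : ℝ) + 1 ≤ b := by exact_mod_cast (show -a + 1 ≤ b by lia)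
  have hR' : (0 : ℝ) ≤ 6 * (2 * a * (a - 1) + b) := by
    have : (0 : ℝ) ≤ 2 * a * (a - 1) + b := by exact_mod_cast hR
    linarith
  set R := Real.sqrt (6 * (2 * a * (a - 1) + b)) with hRdef
  have hR0 : 0 ≤ R := Real.sqrt_nonneg _
  have hR2 : R ^ 2 = 6 * (2 * a * (a - 1) + b) := Real.sq_sqrt hR'
  generalize hA : (a : ℝ) = A at *
  generalize hB : (b : ℝ) = B at *
  generalize hN : (n : ℝ) = N at *
  have hc : 0 < 4 * A ^ 2 - 2 * A + B := by nlinarith only [ha1, hb1]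
  -- the left side of the hypothesis, multiplied by `12 * A`
  have hm : (3 * (4 * A ^ 2 - 2 * A + B) + 4 * A * R) ^ 2
      < 12 * A * N - 12 * A ^ 2 + 12 * A * B + 9 * B ^ 2 := by
    have := mul_lt_mul_of_pos_left hn (show 0 < 12 * A by linarith)
    have h2 : (4 * A * R) ^ 2 = 16 * A ^ 2 * (6 * (2 * A * (A - 1) + B)) := by
      rw [mul_pow, hR2]; ring
    nlinarith only [this, h2]
  have hcR : 0 < 3 * (4 * A ^ 2 - 2 * A + B) + 4 * A * R := by positivity
  obtain ⟨Y, hY⟩ : ∃ Y, Y = Real.sqrt (12 * A * N - 12 * A ^ 2 + 12 * A * B + 9 * B ^ 2) :=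
    ⟨_, rfl⟩
  have hYpos : 0 ≤ 12 * A * N - 12 * A ^ 2 + 12 * A * B + 9 * B ^ 2 :=
    ((sq_nonneg _).trans_lt hm).le
  have hY0 : 0 ≤ Y := hY ▸ Real.sqrt_nonneg _
  have hY2 : Y ^ 2 = 12 * A * N - 12 * A ^ 2 + 12 * A * B + 9 * B ^ 2 := by
    rw [hY, Real.sq_sqrt hYpos]
  have hYm : 3 * (4 * A ^ 2 - 2 * A + B) + 4 * A * R < Y := by
    rw [hY]
    exact Real.lt_sqrt_of_sq_lt hm
  have hq : 0 < 2 * A ^ 2 - A + B := by nlinarith only [ha1, hb1]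
  have hNlow : A - B + 3 * (2 * A - 1) * (2 * A ^ 2 - A + B) < N := by
    have h1 : (3 * (4 * A ^ 2 - 2 * A + B)) ^ 2
        ≤ (3 * (4 * A ^ 2 - 2 * A + B) + 4 * A * R) ^ 2 :=
      pow_le_pow_left₀ (by linarith) (le_add_of_nonneg_right (by positivity)) 2
    refine lt_of_mul_lt_mul_left (a := 12 * A) ?_ (by linarith)
    nlinarith only [h1, hm]
  have hq' : 2 * A ^ 2 - A + B ≤ (2 * A - 1) * (2 * A ^ 2 - A + B) :=
    le_mul_of_one_le_left hq.le (by linarith)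
  have hNA : A - B ≤ N := by linarith
  have hN0 : 0 < N := by nlinarith only [hNlow, hq', ha1, hb1]
  obtain ⟨X, hX⟩ : ∃ X, X = Real.sqrt (B ^ 2 + A * N) := ⟨_, rfl⟩
  have hX0 : 0 ≤ X := hX ▸ Real.sqrt_nonneg _
  have hX2 : X ^ 2 = B ^ 2 + A * N := by
    rw [hX, Real.sq_sqrt (by positivity)]
  have hXY : Y + (4 * A ^ 2 - 2 * A + B) < 4 * X := by
    refine lt_of_pow_lt_pow_left₀ 2 (by positivity) ?_
    have h1 : (4 * A * R) ^ 2 < (Y - 3 * (4 * A ^ 2 - 2 * A + B)) ^ 2 := by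
      exact pow_lt_pow_left₀ (by linarith) (by positivity) two_ne_zero
    rw [mul_pow, hR2] at h1
    nlinarith only [h1, hY2, hX2]
  have hXB : |B| < X := by
    refine lt_of_pow_lt_pow_left₀ 2 hX0 ?_
    rw [sq_abs, hX2]
    have : 0 < A * N := by positivity
    linarith
  have hYB : 3 * B ≤ Y := by
    refine le_of_abs_le (abs_le_of_sq_le_sq ?_ hY0)
    have : 0 ≤ A * (N - (A - B)) := mul_nonneg (by linarith) (by linarith)
    nlinarith only [this, hY2]
  have hA0 : 0 < A := by linarith
  obtain ⟨s, hs, hL, hU⟩ := exists_modEq_between r (2 * a) (by lia)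
    (L := (Y - 2 * A - 3 * B) / (2 * A)) (U := 2 * (X - B) / A) (by
      push_cast
      rw [hA, div_sub_div _ _ hA0.ne' (by positivity), lt_div_iff₀ (by positivity)]
      nlinarith only [mul_lt_mul_of_pos_left hXY hA0])
  rw [div_lt_iff₀ (by positivity)] at hL
  rw [lt_div_iff₀ hA0] at hU
  have hs0 : 0 ≤ s := by
    have : (-1 : ℝ) < s := by
      by_contra h
      nlinarith only [h, hL, hYB, hA0]
    have : -1 < s := by exact_mod_cast this
    lia
  have hs0' : (0 : ℝ) ≤ s := by exact_mod_cast hs0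
  obtain ⟨hB1, hB2⟩ := abs_lt.1 hXB
  refine ⟨s, hs, hs0, ?_, ?_⟩
  · have h1 : (A * s + 2 * B) ^ 2 < (2 * X) ^ 2 := by
      refine sq_lt_sq' ?_ (by linarith)
      have := mul_nonneg hA0.le hs0'
      linarith
    have h2 : A * (A * s ^ 2 + 4 * B * s) < A * (4 * N) := by nlinarith only [h1, hX2]
    have h3 := lt_of_mul_lt_mul_left h2 hA0.le
    rw [← hA, ← hB, ← hN] at h3
    exact_mod_cast h3
  · have h1 : Y ^ 2 < (2 * A * s + 2 * A + 3 * B) ^ 2 :=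
      pow_lt_pow_left₀ (by linarith) hY0 two_ne_zero
    have h2 : A * (3 * N) < A * (A * s ^ 2 + (2 * A + 3 * B) * s + 4 * A) := by
      nlinarith only [h1, hY2]
    have h3 := lt_of_mul_lt_mul_left h2 hA0.le
    rw [← hA, ← hB, ← hN] at h3
    exact_mod_cast h3

/-! ### Four terms, then five -/

theorem exists_four_of_lt {a b : ℤ} (ha : 0 < a) (hb : -a < b) (hb2 : Even b)
    (hab : Int.gcd a b = 1) {n : ℤ} (hn4 : ¬ n ≡ 0 [ZMOD 4])
    (hn : 4 * (a : ℝ) * (7 * a * (a - 1) + 1) + 2 * (7 * a - 2) * b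
          + 2 * (2 * a * (2 * a - 1) + b) * Real.sqrt (6 * (2 * a * (a - 1) + b)) < (n : ℝ)) :
    ∃ w x y z : ℕ,
      n = w * (a * w + b) + x * (a * x + b) + y * (a * y + b) + z * (a * z + b) := by
  have hodd : Odd a := by
    by_contra h
    rw [Int.not_odd_iff_even] at h
    have := Int.dvd_coe_gcd h.two_dvd hb2.two_dvd
    rw [hab] at this
    norm_num at this
  have hR : 0 ≤ 2 * a * (a - 1) + b := by
    rcases (show a = 1 ∨ 2 ≤ a by lia) with rfl | h
    · lia
    · nlinarith
  obtain ⟨r, hr⟩ := exists_residue (n := n) hodd hab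
  obtain ⟨s, hs, hs0, h1, h2⟩ := exists_bounded_residue ha hb r hn hR
  obtain ⟨⟨q, hq⟩, hsn⟩ := hr s hs
  have hn' : n = a * q + b * s := by linarith
  subst hn'
  obtain ⟨w, x, y, z, hsum, hsq⟩ := exists_nat_sum_eq_sum_sq_eq (q := q) (s := s) (by
    obtain ⟨b', rfl⟩ := hb2.two_dvd
    obtain ⟨a', rfl⟩ := hodd
    -- If s is even then 4 ∣ bs, so n ≡ aq mod 4 with n even and 4 ∤ n forces q ≡ 2 mod 4.
    rcases Int.even_or_odd s with h | h
    · obtain ⟨s', rfl⟩ := h.two_dvd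
      refine Or.inr ⟨?_, h⟩
      rw [Int.modEq_zero_iff_dvd] at hn4
      have e1 : (2 * a' + 1) * q + 2 * b' * (2 * s') = 2 * (a' * q) + q + 4 * (b' * s') := by ring
      rw [e1] at hn4 hsn
      obtain ⟨q', rfl⟩ : (2 : ℤ) ∣ q := by lia
      have e2 : a' * (2 * q') = 2 * (a' * q') := by ring
      rw [e2] at hn4
      lia
    · have e1 : (2 * a' + 1) * q + 2 * b' * s = 2 * (a' * q) + q + 2 * (b' * s) := by ring
      rw [e1] at hsn
      refine Or.inl ⟨?_, h⟩
      rw [Int.odd_iff] at h ⊢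
      lia) hs0 (by
      refine le_of_mul_le_mul_left ?_ ha
      linarith) (by
      refine lt_of_mul_lt_mul_left ?_ ha.le
      linarith)
  exact ⟨w, x, y, z, by rw [← hsum, ← hsq]; ring⟩

theorem theorem1p3 (a b : ℤ) (ha : 0 < a) (hb : -a < b) (hb2 : Even b)
    (hab : Int.gcd a b = 1) :
    (∀ n : ℤ, ¬ n ≡ 0 [ZMOD 4] →
      4 * (a : ℝ) * (7 * a * (a - 1) + 1) + 2 * (7 * a - 2) * b
          + 2 * (2 * a * (2 * a - 1) + b) * Real.sqrt (6 * (2 * a * (a - 1) + b)) < (n : ℝ) →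
      ∃ w x y z : ℕ,
        n = w * (a * w + b) + x * (a * x + b) + y * (a * y + b) + z * (a * z + b)) ∧
    IsAsymptoticBase {m : ℤ | ∃ x : ℕ, m = x * (a * x + b)} 5 := by
  have main := fun n h1 h2 => exists_four_of_lt ha hb hb2 hab (n := n) h1 h2
  refine ⟨main, ?_, ?_⟩
  · rintro m ⟨x, rfl⟩
    rcases Nat.eq_zero_or_pos x with rfl | hx
    · simp
    · have hx' : (1 : ℤ) ≤ x := by exact_mod_cast hx
      have : 0 ≤ a * x + b := by nlinarith
      positivity
  · obtain ⟨T, hT⟩ := exists_int_gt (4 * (a : ℝ) * (7 * a * (a - 1) + 1) + 2 * (7 * a - 2) * b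
          + 2 * (2 * a * (2 * a - 1) + b) * Real.sqrt (6 * (2 * a * (a - 1) + b)))
    refine (Set.finite_Ico 0 (T + (a + b))).subset ?_
    rintro m ⟨hm0, hm⟩
    refine ⟨hm0, ?_⟩
    by_contra hlt
    push Not at hlt
    apply hm
    obtain ⟨v, hv1, hv4⟩ : ∃ v : ℕ, T ≤ m - v * (a * v + b) ∧
        ¬ m - v * (a * v + b) ≡ 0 [ZMOD 4] := by
      by_cases h4 : m ≡ 0 [ZMOD 4]
      -- The term a + b is odd, so subtracting it leaves the multiples of 4.
      · refine ⟨1, by push_cast; linarith, fun h => ?_⟩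
        have hdvd : (2 : ℤ) ∣ a := by
          obtain ⟨b', rfl⟩ := hb2.two_dvd
          rw [Int.modEq_zero_iff_dvd] at h h4
          push_cast at h
          lia
        have := Int.dvd_coe_gcd hdvd hb2.two_dvd
        rw [hab] at this
        norm_num at this
      · refine ⟨0, by push_cast; linarith, by simpa using h4⟩
    obtain ⟨w, x, y, z, h⟩ := main _ hv4 (hT.trans_le (by exact_mod_cast hv1))
    have hmem : ∀ k : ℕ, (k : ℤ) * (a * k + b) ∈ {m : ℤ | ∃ x : ℕ, m = x * (a * x + b)} :=
      fun k => ⟨k, rfl⟩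
    refine ⟨fun i => (![v, w, x, y, z] i : ℕ) * (a * (![v, w, x, y, z] i : ℕ) + b),
      fun i => hmem _, ?_⟩
    simp [Fin.sum_univ_succ]
    linarith
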